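/- Let $d \ge 1$, and equip $\mathbb{F}^d$ ($\mathbb{F}=\mathbb{R}$ or $\mathbb{C}$) with the quadratic form $\|x\|^2=\sum_{i=1}^d x_i^2$, whose isometries are the maps $x\mapsto Ax+b$ with $A^TA=AA^T=I_d$. Let $G=(V,E)$ be a finite simple graph. A realisation of $G$ in $\mathbb{F}^d$ is a map $p:V\to\mathbb{F}^d$; it is generic if its $d|V|$ coordinates are algebraically independent over $\mathbb{Q}$. Realisations $p,q$ of $G$ are equivalent if $\|p(v)-p(w)\|^2=\|q(v)-q(w)\|^2$ for every edge $vw\in E$, and congruent ($p\sim q$) if an isometry of $\mathbb{F}^d$ sends $p$ to $q$. The framework $(G,p)$ is rigid if for every $\varepsilon>0$ and every continuous path $\rho:(-\varepsilon,\varepsilon)\to(\mathbb{F}^d)^V$ with $\rho_0=p$ and all $\rho_t$ equivalent to $p$, all $\rho_t$ are congruent to $p$. The graph $G$ is $d$-rigid if some generic framework $(G,p)$ in $\mathbb{R}^d$ or $\mathbb{C}^d$ is rigid, and minimally $d$-rigid if moreover $G-e$ is not $d$-rigid for any $e\in E$. The real $d$-realisation number of $G$ is \[ r_d(G)=\sup\Bigl\{\,\bigl|\{q\in(\mathbb{R}^d)^V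 : q \text{ equivalent to } p\}/\!\sim\bigr| \;:\; p:V\to\mathbb{R}^d \text{ generic}\Bigr\}\in\mathbb{N}\cup\{\infty\}. \] A $d$-dimensional vertex-split takes a vertex $x$ of $G$ and a partition of its neighbourhood into (possibly empty) sets $N_1$, $N_2$ and $\{w_1,\dots,w_{d-1}\}$ (with $w_1,\dots,w_{d-1}$ distinct), and outputs the graph obtained from $G-x$ by adding two new vertices $x_1,x_2$, joining $x_i$ to all vertices of $N_i\cup\{w_1,\dots,w_{d-1}\}$ for $i=1,2$, and adding the edge $x_1x_2$. Theorem. Let $G=(V,E)$ be minimally $d$-rigid with at least $d+1$ vertices and let $G'$ be formed from $G$ by a $d$-dimensional vertex-split. Then $r_d(G')\ge 2\,r_d(G)$. -/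

import Mathlib

namespace Rigidity

/-- A realisation of a graph on `V` in `𝕜 ^ d`. The space `𝕜 ^ d` carries the quadratic form
`∑ i, x i ^ 2` (no complex conjugation when `𝕜 = ℂ`). -/
abbrev Realisation (𝕜 : Type*) (d : ℕ) (V : Type*) := V → Fin d → 𝕜

section Field

variable {𝕜 : Type*} [RCLike 𝕜] {d : ℕ} {V : Type*}

/-- The value of the quadratic form at `x - y`. -/
def sqDist (x y : Fin d → 𝕜) : 𝕜 := ∑ i, (x i - y i) ^ 2

/-- The `d * |V|` coordinates of `p` are algebraically independent over `ℚ`. -/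
def IsGeneric (p : Realisation 𝕜 d V) : Prop :=
  AlgebraicIndependent ℚ (fun vi : V × Fin d => p vi.1 vi.2)

/-- `p` and `q` give all edges of `G` the same squared lengths. -/
def Equivalent (G : SimpleGraph V) (p q : Realisation 𝕜 d V) : Prop :=
  ∀ v w, G.Adj v w → sqDist (p v) (p w) = sqDist (q v) (q w)

/-- Some isometry `x ↦ A x + b`, with `A` in `O(d, 𝕜)`, sends `p` to `q`. -/
def Congruent (p q : Realisation 𝕜 d V) : Prop :=
  ∃ (A : Matrix (Fin d) (Fin d) 𝕜) (b : Fin d → 𝕜),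
    A.transpose * A = 1 ∧ A * A.transpose = 1 ∧ ∀ v, q v = A.mulVec (p v) + b

theorem congruent_equivalence :
    Equivalence (Congruent : Realisation 𝕜 d V → Realisation 𝕜 d V → Prop) where
  refl p := ⟨1, 0, by simp, by simp, fun v => by simp⟩
  symm := by
    rintro p q ⟨A, b, h₁, h₂, h⟩
    refine ⟨A.transpose, -(A.transpose.mulVec b), by simpa using h₂, by simpa using h₁, fun v => ?_⟩
    rw [h v, Matrix.mulVec_add, Matrix.mulVec_mulVec, h₁, Matrix.one_mulVec]
    abel
  trans := by
    rintro p q r ⟨A, b, h₁, h₂, h⟩ ⟨B, c, k₁, k₂, k⟩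
    refine ⟨B * A, B.mulVec b + c, ?_, ?_, fun v => ?_⟩
    · rw [Matrix.transpose_mul, Matrix.mul_assoc, ← Matrix.mul_assoc B.transpose, k₁,
        Matrix.one_mul, h₁]
    · rw [Matrix.transpose_mul, Matrix.mul_assoc, ← Matrix.mul_assoc A, h₂,
        Matrix.one_mul, k₂]
    · rw [k v, h v, Matrix.mulVec_add, Matrix.mulVec_mulVec, add_assoc]

/-- The framework `(G, p)` is rigid: every continuous flex, i.e. every continuous path
`ρ : (-ε, ε) → (𝕜 ^ d) ^ V` of realisations equivalent to `p` with `ρ 0 = p`, is trivial. -/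
def IsRigid (G : SimpleGraph V) (p : Realisation 𝕜 d V) : Prop :=
  ∀ (ε : ℝ) (ρ : ℝ → Realisation 𝕜 d V), 0 < ε →
    ContinuousOn ρ (Set.Ioo (-ε) ε) → ρ 0 = p →
    (∀ t ∈ Set.Ioo (-ε) ε, Equivalent G p (ρ t)) →
    ∀ t ∈ Set.Ioo (-ε) ε, Congruent p (ρ t)

end Field

section Graph

variable {V : Type*}

/-- `G` is `d`-rigid: some generic framework `(G, p)` in `ℝ ^ d` or in `ℂ ^ d` is rigid. -/
def IsDRigid (d : ℕ) (G : SimpleGraph V) : Prop :=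
  (∃ p : Realisation ℝ d V, IsGeneric p ∧ IsRigid G p) ∨
    (∃ p : Realisation ℂ d V, IsGeneric p ∧ IsRigid G p)

/-- `G` is `d`-rigid, and deleting any edge destroys `d`-rigidity. -/
def IsMinimallyDRigid (d : ℕ) (G : SimpleGraph V) : Prop :=
  IsDRigid d G ∧ ∀ e ∈ G.edgeSet, ¬ IsDRigid d (G.deleteEdges {e})

/-- Congruence on the set of real realisations equivalent to `p`. -/
def congruenceSetoid {d : ℕ} (G : SimpleGraph V) (p : Realisation ℝ d V) :
    Setoid {q : Realisation ℝ d V // Equivalent G p q} :=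
  Setoid.comap Subtype.val ⟨Congruent, congruent_equivalence⟩

/-- `r(G, p)`: the number of real realisations equivalent to `p`, up to congruence. -/
noncomputable def realisationCount {d : ℕ} (G : SimpleGraph V) (p : Realisation ℝ d V) : ℕ∞ :=
  ENat.card (Quotient (congruenceSetoid G p))

/-- `r_d(G)`: the largest value of `r(G, p)` over all generic real `p`, as a supremum in `ℕ∞`. -/
noncomputable def realRealisationNumber (d : ℕ) (G : SimpleGraph V) : ℕ∞ :=
  ⨆ (p : Realisation ℝ d V) (_ : IsGeneric p), realisationCount G p

/-- The graph formed from `G - x` by adding two adjacent new vertices `inr 0` and `inr 1`, where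
`inr i` is joined to all vertices of `N i` and of `W`. -/
def vertexSplit (G : SimpleGraph V) (x : V) (N : Fin 2 → Set V) (W : Set V) :
    SimpleGraph ({v : V // v ≠ x} ⊕ Fin 2) where
  Adj
    | .inl a, .inl b => G.Adj a b
    | .inl a, .inr i => (a : V) ∈ N i ∪ W
    | .inr i, .inl a => (a : V) ∈ N i ∪ W
    | .inr i, .inr j => i ≠ j
  symm := ⟨by
    rintro (a | i) (b | j) h
    · exact G.symm.symm _ _ h
    · exact h
    · exact h
    · exact Ne.symm h⟩
  loopless := ⟨by
    rintro (a | i) h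
    · exact G.loopless.irrefl _ h
    · exact h rfl⟩

/-- `G'` is (up to isomorphism) formed from `G` by a `d`-dimensional vertex-split: the
neighbourhood of a vertex `x` is partitioned into `N 0`, `N 1` and a set `W` of `d - 1` vertices
(any of these may be empty), and `x` is split accordingly. -/
def IsVertexSplit {V' : Type*} (d : ℕ) (G : SimpleGraph V) (G' : SimpleGraph V') : Prop :=
  ∃ (x : V) (N : Fin 2 → Set V) (W : Set V),
    N 0 ∪ N 1 ∪ W = G.neighborSet x ∧
    Disjoint (N 0) (N 1) ∧ Disjoint (N 0) W ∧ Disjoint (N 1) W ∧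
    W.ncard = d - 1 ∧
    Nonempty (G' ≃g vertexSplit G x N W)

end Graph

end Rigidity

/-! ### Derivations and algebraic independence -/

namespace Rigidity

open MvPolynomial

/-! Place the two copies of `x` at `q x` and `q x + t u`, and let `t` tend to 0. Dividing by `t` the
difference between the two squared lengths at each common neighbour, and by `t ^ 2` the squared
length of the new edge, gives a system that still makes sense at `t = 0`. There `q` has the edge
lengths of a realisation of `G`, and `u` is a unit vector orthogonal to the `d - 1` vectors `q x - q
w`. When these are independent there are exactly two choices, `±n`, so each `q` yields two limit
solutions.

The limits survive for small `t ≠ 0` because the system is a submersion at each of them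
(`map_nhds_splitMap`). For the part in `q`, minimal rigidity makes the edge lengths of a generic `p`
algebraically independent. An equivalent `q`, generic or not, has the same lengths, and derivations
with prescribed values on them show that the edge map is a submersion at `q`
(`surjective_fderiv_edgeMap`). So finitely many equivalent realisations can be moved together until
the star of `x` spans in each (`exists_perturbation_mem_dense`).

All limit solutions have the same value under the rescaled system, which is open at each of them.
Some generic split realisation with `t ≠ 0` therefore has an equivalent one near every limit, and
continuous congruence invariants keep these apart. -/

/-- Over a field of characteristic zero, every assignment of values to an algebraically independent
family is realised by a derivation. -/
theorem exists_derivation_of_algebraicIndependent {ι L : Type*} [Field L] [CharZero L]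
    {x : ι → L} (hx : AlgebraicIndependent ℚ x) (c : ι → L) :
    ∃ D : Derivation ℚ L L, ∀ i, D (x i) = c i := by
  classical
  obtain ⟨t, hst, ht⟩ := exists_isTranscendenceBasis_superset (R := ℚ) (s := Set.range x)
    hx.coe_range
  let : Algebra (MvPolynomial t ℚ) L := (aeval ((↑) : t → L)).toAlgebra
  have hmap : ∀ y, algebraMap (MvPolynomial t ℚ) L y = aeval ((↑) : t → L) y := fun _ => rfl
  have : IsScalarTower ℚ (MvPolynomial t ℚ) L :=
    IsScalarTower.of_algebraMap_eq fun r => by rw [hmap]; simp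
  have : FaithfulSMul (MvPolynomial t ℚ) L := (faithfulSMul_iff_algebraMap_injective _ _).2 ht.1
  have : Algebra.IsAlgebraic (MvPolynomial t ℚ) L := by
    have h := ht.isAlgebraic
    exact h.of_ringHom_of_comp_eq ht.1.aevalEquiv.toRingEquiv (RingHom.id L)
      (RingEquiv.surjective _) Function.injective_id (by ext y <;> simp [hmap])
  let : Algebra (FractionRing (MvPolynomial t ℚ)) L := FractionRing.liftAlgebra _ _
  have : IsScalarTower (MvPolynomial t ℚ) (FractionRing (MvPolynomial t ℚ)) L :=
    FractionRing.isScalarTower_liftAlgebra _ _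
  have : Algebra.IsAlgebraic (FractionRing (MvPolynomial t ℚ)) L :=
    (IsFractionRing.comap_isAlgebraic_iff (A := MvPolynomial t ℚ)).1 inferInstance
  -- Algebraic extensions in characteristic zero are separable, hence formally étale. So `Ω[L⁄ℚ]` is
  -- the base change of the differentials of `ℚ[t]`, and derivations of `ℚ[t]` into `L` extend to
  -- `L`.
  have : Algebra.FormallyEtale (FractionRing (MvPolynomial t ℚ)) L :=
    Algebra.FormallyEtale.of_isSeparable _ L
  have : Algebra.FormallyEtale (MvPolynomial t ℚ) (FractionRing (MvPolynomial t ℚ)) :=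
    .of_isLocalization (nonZeroDivisors _)
  have : Algebra.FormallyEtale (MvPolynomial t ℚ) L :=
    .comp _ (FractionRing (MvPolynomial t ℚ)) _
  have hinj : Function.Injective x := hx.injective
  -- Values on basis elements outside the family are free; 0 is chosen.
  let g : t → L := fun y => if h : ∃ i, x i = y then c h.choose else 0
  let D₀ : Derivation ℚ (MvPolynomial t ℚ) L := mkDerivation ℚ g
  let e := KaehlerDifferential.tensorKaehlerEquivOfFormallyEtale ℚ (MvPolynomial t ℚ) L
  let φ : Ω[L⁄ℚ] →ₗ[L] L :=
    (D₀.liftKaehlerDifferential.liftBaseChange L) ∘ₗ e.symm.toLinearMap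
  refine ⟨φ.compDer (KaehlerDifferential.D ℚ L), fun i => ?_⟩
  have hi : x i = algebraMap (MvPolynomial t ℚ) L (X ⟨x i, hst ⟨i, rfl⟩⟩) := by
    rw [hmap]; simp
  have hg : g ⟨x i, hst ⟨i, rfl⟩⟩ = c i := by
    have h : ∃ j, x j = x i := ⟨i, rfl⟩
    simp only [g, dif_pos h]
    exact congrArg c (hinj h.choose_spec)
  change D₀.liftKaehlerDifferential.liftBaseChange L (e.symm (KaehlerDifferential.D ℚ L (x i))) = _
  rw [show KaehlerDifferential.D ℚ L (x i) = KaehlerDifferential.D ℚ L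
    (algebraMap (MvPolynomial t ℚ) L (X ⟨x i, hst ⟨i, rfl⟩⟩)) from congrArg _ hi]
  simp only [e, KaehlerDifferential.tensorKaehlerEquivOfFormallyEtale_symm_D_algebraMap,
    LinearMap.liftBaseChange_tmul, one_smul, Derivation.liftKaehlerDifferential_comp_D, D₀,
    mkDerivation_X, hg]

/-! ### Edge lengths of minimally rigid graphs -/

section EdgeLengths

variable {𝕜 : Type*} [RCLike 𝕜] {d : ℕ} {V : Type*}

theorem sqDist_comm (x y : Fin d → 𝕜) : sqDist x y = sqDist y x :=
  Finset.sum_congr rfl fun i _ => by ring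

/-- The squared length of the edge `e` in the realisation `q`. -/
noncomputable def sqLength (q : Realisation 𝕜 d V) (e : Sym2 V) : 𝕜 :=
  sqDist (q e.out.1) (q e.out.2)

theorem sqLength_mk (q : Realisation 𝕜 d V) (v w : V) :
    sqLength q s(v, w) = sqDist (q v) (q w) := by
  have h : s((s(v, w)).out.1, (s(v, w)).out.2) = s(v, w) := Quot.out_eq _
  rcases Sym2.eq_iff.1 h with ⟨h₁, h₂⟩ | ⟨h₁, h₂⟩
  · rw [sqLength, h₁, h₂]
  · rw [sqLength, h₁, h₂, sqDist_comm]

theorem equivalent_iff_sqLength (G : SimpleGraph V) (p q : Realisation 𝕜 d V) :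
    Equivalent G p q ↔ ∀ e : G.edgeSet, sqLength p e = sqLength q e := by
  constructor
  · rintro h ⟨e, he⟩
    induction e with
    | _ v w => simpa [sqLength_mk] using h v w he
  · intro h v w hvw
    simpa [sqLength_mk] using h ⟨s(v, w), hvw⟩

/-- The squared length of `e` as a polynomial in the coordinates of a realisation. -/
noncomputable def lengthPoly (d : ℕ) (e : Sym2 V) : MvPolynomial (V × Fin d) ℚ :=
  ∑ i, (X (e.out.1, i) - X (e.out.2, i)) ^ 2

/-- Evaluation of polynomials at the coordinates of a realisation. -/
noncomputable def evalAt (q : Realisation 𝕜 d V) : MvPolynomial (V × Fin d) ℚ →ₐ[ℚ] 𝕜 :=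
  aeval fun vi => q vi.1 vi.2

theorem evalAt_lengthPoly (q : Realisation 𝕜 d V) (e : Sym2 V) :
    evalAt q (lengthPoly d e) = sqLength q e := by
  simp [evalAt, lengthPoly, sqLength, sqDist]

theorem IsGeneric.evalAt_injective {p : Realisation 𝕜 d V} (hp : IsGeneric p) :
    Function.Injective (evalAt p) := hp

theorem continuous_sqLength (e : Sym2 V) :
    Continuous fun q : Realisation 𝕜 d V => sqLength q e := by
  unfold sqLength sqDist
  fun_prop

/-- If the squared length of `e` is algebraic over the squared lengths of other edges of `G`, then
deleting `e` preserves the rigidity of generic frameworks. -/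
theorem isRigid_deleteEdges {G : SimpleGraph V} {p : Realisation 𝕜 d V} (hp : IsGeneric p)
    (hr : IsRigid G p) {t : Set G.edgeSet} {e : G.edgeSet} (he : e ∉ t)
    (halg : IsAlgebraic (Algebra.adjoin ℚ ((fun e : G.edgeSet => lengthPoly d (e : Sym2 V)) '' t))
      (lengthPoly d (e : Sym2 V))) :
    IsRigid (G.deleteEdges {(e : Sym2 V)}) p := by
  intro ε ρ hε hρ h0 heq
  refine hr ε ρ hε hρ h0 fun s hs => (equivalent_iff_sqLength _ _ _).2 fun e' => ?_
  have hlen : ∀ s ∈ Set.Ioo (-ε) ε, ∀ f : G.edgeSet, f ≠ e → sqLength p f = sqLength (ρ s) f :=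
    fun s hs f hf => (equivalent_iff_sqLength _ _ _).1 (heq s hs)
      ⟨f, by
        rw [SimpleGraph.edgeSet_deleteEdges]
        exact ⟨f.2, fun h => hf (Subtype.ext h)⟩⟩
  by_cases hee : e' = e
  swap
  · exact hlen s hs e' hee
  subst hee
  set B := Algebra.adjoin ℚ ((fun e : G.edgeSet => lengthPoly d (e : Sym2 V)) '' t)
  obtain ⟨Q, hQ0, hQ⟩ := halg
  let ev : Realisation 𝕜 d V → B →+* 𝕜 := fun q => (evalAt q).toRingHom.comp (algebraMap B _)
  have hev : ∀ s ∈ Set.Ioo (-ε) ε, ev (ρ s) = ev p := by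
    intro s hs
    have : (evalAt (ρ s)).comp B.val = (evalAt p).comp B.val := by
      refine AlgHom.adjoin_ext ?_
      rintro _ ⟨f, hf, rfl⟩
      change evalAt (ρ s) (lengthPoly d (f : Sym2 V)) = evalAt p (lengthPoly d (f : Sym2 V))
      rw [evalAt_lengthPoly, evalAt_lengthPoly, hlen s hs f (fun h => he (h ▸ hf))]
    exact RingHom.ext fun b => DFunLike.congr_fun this b
  -- Genericity of `p` keeps the algebraic relation nontrivial after evaluation.
  have hinj : Function.Injective (ev p) :=
    hp.evalAt_injective.comp Subtype.val_injective
  have hne : Q.map (ev p) ≠ 0 := (Polynomial.map_ne_zero_iff hinj).2 hQ0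
  have hmaps : Set.MapsTo (fun s => sqLength (ρ s) e') (Set.Ioo (-ε) ε)
      {z | (Q.map (ev p)).IsRoot z} := by
    intro s hs
    change Polynomial.eval (sqLength (ρ s) (e' : Sym2 V)) _ = 0
    have h := congrArg (evalAt (ρ s)) hQ
    rw [map_zero, Polynomial.aeval_def] at h
    rw [← hev s hs, Polynomial.eval_map, ← evalAt_lengthPoly]
    rw [← h]
    exact (Polynomial.hom_eval₂ Q (algebraMap B _) (evalAt (ρ s)).toRingHom _).symm
  have h0' : (0 : ℝ) ∈ Set.Ioo (-ε) ε := ⟨by linarith, hε⟩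
  -- Along the flex the length of the deleted edge stays among the finitely many roots of one
  -- polynomial, so by continuity it is constant.
  have := isPreconnected_Ioo.constant_of_mapsTo (Polynomial.finite_setOfPred_isRoot hne).isDiscrete
    ((continuous_sqLength (e' : Sym2 V)).comp_continuousOn hρ) hmaps h0' hs
  simpa [h0] using this

/-- The squared edge lengths of a minimally `d`-rigid graph are algebraically independent. -/
theorem IsMinimallyDRigid.algebraicIndependent {G : SimpleGraph V} (hG : IsMinimallyDRigid d G) :
    AlgebraicIndependent ℚ fun e : G.edgeSet => lengthPoly d (e : Sym2 V) := by
  refine algebraicIndependent_of_finite_type' (C_injective _ _) fun t _ _ e he halg => ?_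
  refine hG.2 e e.2 ?_
  rcases hG.1 with ⟨p, hp, hr⟩ | ⟨p, hp, hr⟩
  · exact Or.inl ⟨p, hp, isRigid_deleteEdges hp hr he halg⟩
  · exact Or.inr ⟨p, hp, isRigid_deleteEdges hp hr he halg⟩

/-- Independence was proved for the length polynomials, so it holds at every generic `p`, real or
complex, whichever framework witnesses rigidity. -/
theorem IsMinimallyDRigid.algebraicIndependent_sqLength {G : SimpleGraph V}
    (hG : IsMinimallyDRigid d G) {p : Realisation 𝕜 d V} (hp : IsGeneric p) :
    AlgebraicIndependent ℚ fun e : G.edgeSet => sqLength p (e : Sym2 V) := by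
  have := hG.algebraicIndependent.map' hp.evalAt_injective
  simpa only [Function.comp_def, evalAt_lengthPoly] using this

end EdgeLengths

end Rigidity

namespace Rigidity

open MvPolynomial Topology Filter

/-! ### Congruence and pairwise distances -/

section Congruence

variable {d : ℕ} {V : Type*}

theorem sqDist_eq_dotProduct (x y : Fin d → ℝ) : sqDist x y = (x - y) ⬝ᵥ (x - y) := by
  simp [sqDist, dotProduct, sq]

theorem Congruent.sqDist_eq {p q : Realisation ℝ d V} (h : Congruent p q) (v w : V) :
    sqDist (p v) (p w) = sqDist (q v) (q w) := by
  obtain ⟨A, b, h₁, -, hq⟩ := h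
  rw [sqDist_eq_dotProduct, sqDist_eq_dotProduct, hq, hq, add_sub_add_right_eq_sub,
    ← Matrix.mulVec_sub, Matrix.dotProduct_mulVec, ← Matrix.mulVec_transpose,
    Matrix.mulVec_mulVec, h₁, Matrix.one_mulVec]

/-- Realisations with the same pairwise distances are congruent. -/
theorem congruent_of_sqDist_eq {p q : Realisation ℝ d V}
    (h : ∀ v w, sqDist (p v) (p w) = sqDist (q v) (q w)) : Congruent p q := by
  classical
  rcases isEmpty_or_nonempty V with hV | ⟨⟨o⟩⟩
  · exact ⟨1, 0, by simp, by simp, fun v => hV.elim v⟩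
  let a : V → EuclideanSpace ℝ (Fin d) := fun v => WithLp.toLp 2 (p v - p o)
  let b : V → EuclideanSpace ℝ (Fin d) := fun v => WithLp.toLp 2 (q v - q o)
  have hdot : ∀ x y z : Fin d → ℝ,
      2 * ((x - z) ⬝ᵥ (y - z)) = sqDist x z + sqDist y z - sqDist x y := by
    intro x y z
    simp only [sqDist, dotProduct, Finset.mul_sum, ← Finset.sum_add_distrib,
      ← Finset.sum_sub_distrib]
    exact Finset.sum_congr rfl fun i _ => by simp only [Pi.sub_apply]; ring
  have hab : ∀ v w, inner ℝ (a v) (a w) = inner ℝ (b v) (b w) := by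
    intro v w
    have h₁ := hdot (p w) (p v) (p o)
    have h₂ := hdot (q w) (q v) (q o)
    rw [h w o, h v o, h w v, ← h₂] at h₁
    simp only [a, b, EuclideanSpace.inner_toLp_toLp, star_trivial]
    linarith
  -- The families `a` and `b` have equal Gram matrices, so `S c ↦ T c` is a well-defined isometry
  -- from the span of `a`; it extends to the whole space.
  let S := Finsupp.linearCombination ℝ a
  let T := Finsupp.linearCombination ℝ b
  have hST : ∀ c, ‖S c‖ = ‖T c‖ := by
    intro c
    have : inner ℝ (S c) (S c) = inner ℝ (T c) (T c) := by
      simp only [S, T, Finsupp.linearCombination_apply, Finsupp.sum_inner, Finsupp.inner_sum,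
        real_inner_smul_left, real_inner_smul_right, hab]
    rw [real_inner_self_eq_norm_sq, real_inner_self_eq_norm_sq] at this
    exact (pow_left_inj₀ (norm_nonneg _) (norm_nonneg _) two_ne_zero).1 this
  obtain ⟨g, hg⟩ := S.rangeRestrict.exists_rightInverse_of_surjective S.range_rangeRestrict
  have hg' : ∀ y, S (g y) = y := fun y => congrArg Subtype.val (LinearMap.congr_fun hg y)
  let L : LinearMap.range S →ₗᵢ[ℝ] EuclideanSpace ℝ (Fin d) :=
    ⟨T ∘ₗ g, fun y => by
      change ‖T (g y)‖ = _
      rw [← hST, hg']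
      rfl⟩
  have hL : ∀ v, L.extend (a v) = b v := by
    intro v
    have ha : S (Finsupp.single v 1) = a v := by simp [S]
    have hb : T (Finsupp.single v 1) = b v := by simp [T]
    rw [← ha, ← hb]
    have := L.extend_apply ⟨S (Finsupp.single v 1), ⟨_, rfl⟩⟩
    rw [this]
    change T (g _) = _
    rw [← sub_eq_zero, ← map_sub, ← norm_eq_zero, ← hST, map_sub, hg', sub_self, norm_zero]
  let A : Matrix (Fin d) (Fin d) ℝ := Matrix.toEuclideanLin.symm L.extend.toLinearMap
  have hA : ∀ x : Fin d → ℝ, WithLp.toLp 2 (A.mulVec x) = L.extend (WithLp.toLp 2 x) := by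
    intro x
    have := Matrix.toLpLin_toLp 2 2 A x
    simpa [A] using this.symm
  have h₁ : A.transpose * A = 1 := by
    have key : ∀ x y : Fin d → ℝ, x ⬝ᵥ ((A.transpose * A).mulVec y) = x ⬝ᵥ y := by
      intro x y
      have := L.extend.inner_map_map (WithLp.toLp 2 y) (WithLp.toLp 2 x)
      rw [← hA, ← hA] at this
      simp only [EuclideanSpace.inner_toLp_toLp, star_trivial] at this
      rw [← this, ← Matrix.mulVec_mulVec, Matrix.dotProduct_mulVec, Matrix.vecMul_transpose]
    ext i j
    have := key (Pi.single i 1) (Pi.single j 1)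
    simpa [Matrix.one_apply, Pi.single_apply, eq_comm] using this
  refine ⟨A, q o - A.mulVec (p o), h₁, mul_eq_one_comm.1 h₁, fun v => ?_⟩
  have := (hA (p v - p o)).trans (hL v)
  have := (WithLp.toLp_injective 2) this
  rw [Matrix.mulVec_sub] at this
  rw [add_sub_left_comm, this]
  abel

end Congruence

/-! ### Density of generic points -/

section Density

/-- Points with algebraically independent coordinates are dense in `ℝ ^ ι`. -/
theorem dense_algebraicIndependent {ι : Type*} [Finite ι] :
    Dense {x : ι → ℝ | AlgebraicIndependent ℚ x} := by
  have hset : {x : ι → ℝ | AlgebraicIndependent ℚ x} =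
      ⋂ P : {P : MvPolynomial ι ℚ // P ≠ 0}, {x | aeval x P.1 ≠ 0} := by
    ext x
    simp only [Set.mem_ofPred_eq, Set.mem_iInter, algebraicIndependent_iff, Subtype.forall]
    exact forall_congr' fun P => not_imp_not.symm
  have : Countable (MvPolynomial ι ℚ) := by
    have := Fintype.ofFinite ι
    rw [← Cardinal.mk_le_aleph0_iff]
    refine cardinalMk_le_max_lift.trans ?_
    simp
  rw [hset]
  -- Baire category for countably many polynomials. A nonzero polynomial cannot vanish on a product
  -- of infinite sets, so each set is dense.
  refine dense_iInter_of_isOpen (fun P => ?_) fun P => ?_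
  · simp only [aeval_def, ← eval_map]
    exact isOpen_ne_fun (MvPolynomial.continuous_eval _) continuous_const
  · rw [dense_iff_inter_open]
    rintro U hU ⟨x, hx⟩
    obtain ⟨u, hu, huU⟩ := isOpen_pi_iff'.1 hU x hx
    by_contra hne
    refine P.2 (map_injective (algebraMap ℚ ℝ) (algebraMap ℚ ℝ).injective ?_)
    rw [map_zero]
    refine funext_set u (fun i => infinite_of_mem_nhds (x i) ((hu i).1.mem_nhds (hu i).2))
      fun y hy => ?_
    by_contra hPy
    refine hne ⟨y, huU hy, ?_⟩
    rw [map_zero, eval_map] at hPy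
    exact hPy

theorem dense_isGeneric {d : ℕ} {V : Type*} [Finite V] :
    Dense {p : Realisation ℝ d V | IsGeneric p} := by
  let e : (V × Fin d → ℝ) → Realisation ℝ d V := fun x v i => x (v, i)
  have he : Continuous e := by fun_prop
  have hs : Function.Surjective e := fun p => ⟨fun vi => p vi.1 vi.2, rfl⟩
  refine (hs.denseRange.dense_image he dense_algebraicIndependent).mono ?_
  rintro _ ⟨x, hx, rfl⟩
  exact hx

end Density

/-! ### The edge length map as a submersion -/

section Derivative

variable {d : ℕ} {V : Type*} (G : SimpleGraph V)

/-- The vector of all squared edge lengths of a realisation of `G`. -/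
noncomputable def edgeMap (q : Realisation ℝ d V) : G.edgeSet → ℝ := fun e => sqLength q (e : Sym2 V)

theorem equivalent_iff_edgeMap {p q : Realisation ℝ d V} :
    Equivalent G p q ↔ edgeMap G p = edgeMap G q := by
  rw [equivalent_iff_sqLength, funext_iff]
  rfl

variable [Fintype V] [Fintype G.edgeSet]

theorem contDiff_edgeMap {n : WithTop ℕ∞} :
    ContDiff ℝ n (edgeMap G : Realisation ℝ d V → G.edgeSet → ℝ) := by
  unfold edgeMap sqLength sqDist
  fun_prop

theorem fderiv_edgeMap_apply (q h : Realisation ℝ d V) (e : G.edgeSet) :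
    fderiv ℝ (edgeMap G) q h e = ∑ i, 2 * (q (e : Sym2 V).out.1 i - q (e : Sym2 V).out.2 i) *
      (h (e : Sym2 V).out.1 i - h (e : Sym2 V).out.2 i) := by
  have h₁ : HasDerivAt (fun s : ℝ => edgeMap G (q + s • h)) (fderiv ℝ (edgeMap G) q h) 0 := by
    have hF : HasFDerivAt (edgeMap G) (fderiv ℝ (edgeMap G) q) (q + (0 : ℝ) • h) := by
      rw [zero_smul, add_zero]
      exact ((contDiff_edgeMap G (n := 1)).differentiable one_ne_zero q).hasFDerivAt
    have hl : HasDerivAt (fun s : ℝ => q + s • h) h 0 := by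
      simpa using ((hasDerivAt_id (0 : ℝ)).smul_const h).const_add q
    exact HasFDerivAt.comp_hasDerivAt (𝕜 := ℝ) 0 hF hl
  have h₂ := hasDerivAt_pi.1 h₁ e
  refine h₂.unique ?_
  simp only [edgeMap, sqLength, sqDist]
  refine HasDerivAt.fun_sum fun i _ => ?_
  have hc : ∀ v, HasDerivAt (fun s : ℝ => (q + s • h) v i) (h v i) 0 := fun v => by
    simpa using ((hasDerivAt_id (0 : ℝ)).mul_const (h v i)).const_add (q v i)
  have hp := ((hc (e : Sym2 V).out.1).fun_sub (hc (e : Sym2 V).out.2)).fun_pow 2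
  simpa using hp

/-- If the squared edge lengths of `q` are algebraically independent, then the edge length map is a
submersion at `q`. -/
theorem surjective_fderiv_edgeMap {q : Realisation ℝ d V}
    (hq : AlgebraicIndependent ℚ (edgeMap G q)) :
    Function.Surjective (fderiv ℝ (edgeMap G) q) := by
  intro c
  obtain ⟨D, hD⟩ := exists_derivation_of_algebraicIndependent hq c
  -- By the Leibniz rule, the derivative of the edge map in the direction `D q` is `D` applied to
  -- the edge lengths.
  refine ⟨fun v i => D (q v i), funext fun e => ?_⟩
  rw [fderiv_edgeMap_apply, ← hD e]
  simp only [edgeMap, sqLength, sqDist, map_sum, Derivation.leibniz_pow, map_sub]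
  refine Finset.sum_congr rfl fun i _ => ?_
  simp [mul_assoc]

/-- Surjectivity says that the rank is at least the dimension of the target, and rank is lower
semicontinuous. -/
theorem isOpen_surjective_fderiv {E F : Type*} [NormedAddCommGroup E] [NormedSpace ℝ E]
    [NormedAddCommGroup F] [NormedSpace ℝ F] [FiniteDimensional ℝ E] [FiniteDimensional ℝ F]
    {f : E → F} (hf : ContDiff ℝ 1 f) : IsOpen {x | Function.Surjective (fderiv ℝ f x)} := by
  have h : ∀ L : E →L[ℝ] F, Function.Surjective L ↔
      (Module.finrank ℝ F : Cardinal) ≤ (L : E →ₗ[ℝ] F).rank := by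
    intro L
    rw [LinearMap.rank, ← Module.finrank_eq_rank, Nat.cast_le]
    constructor
    · intro hL
      rw [(LinearMap.range_eq_top (f := (L : E →ₗ[ℝ] F))).2 hL, finrank_top]
    · intro hL
      exact (LinearMap.range_eq_top (f := (L : E →ₗ[ℝ] F))).1
        (Submodule.eq_top_of_finrank_eq (le_antisymm (Submodule.finrank_le _) hL))
  simp only [h]
  exact (isOpen_setOfPred_nat_le_rank _).preimage (hf.continuous_fderiv one_ne_zero)

end Derivative

end Rigidity

namespace Rigidity

open Topology Filter

/-! ### Perturbation in fibres and openness -/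

section Submersion

variable {E F : Type*} [NormedAddCommGroup E] [NormedSpace ℝ E] [NormedAddCommGroup F]
  [NormedSpace ℝ F] [FiniteDimensional ℝ E] [FiniteDimensional ℝ F]

/-- A finite family of points in a common fibre of `f` at which `f` is a submersion can be moved
into a dense open set, keeping the values of `f` equal. -/
theorem exists_perturbation_mem_dense {ι : Type*} [Finite ι] {f : E → F} (hf : ContDiff ℝ 1 f)
    {q : ι → E} {y : F} (hq : ∀ i, f (q i) = y)
    (hs : ∀ i, Function.Surjective (fderiv ℝ f (q i))) {U : ι → Set E} (hU : ∀ i, U i ∈ 𝓝 (q i))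
    {D : Set E} (hDo : IsOpen D) (hD : Dense D) :
    ∃ (q' : ι → E) (y' : F), ∀ i, q' i ∈ U i ∧ q' i ∈ D ∧ f (q' i) = y' ∧
      Function.Surjective (fderiv ℝ f (q' i)) := by
  have := FiniteDimensional.complete ℝ E
  have := FiniteDimensional.complete ℝ F
  have hopen : ∀ O : Set E, IsOpen O → (∀ x ∈ O, Function.Surjective (fderiv ℝ f x)) →
      IsOpen (f '' O) := by
    intro O hO hsurj
    rw [isOpen_iff_mem_nhds]
    rintro _ ⟨x, hx, rfl⟩
    rw [← (hf.contDiffAt.hasStrictFDerivAt one_ne_zero).map_nhds_eq_of_surj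
      (LinearMap.range_eq_top.2 (hsurj x hx))]
    exact image_mem_map (hO.mem_nhds hx)
  let S : ι → Set E := fun i => interior (U i) ∩ {x | Function.Surjective (fderiv ℝ f x)}
  have hSo : ∀ i, IsOpen (S i) := fun i => isOpen_interior.inter (isOpen_surjective_fderiv hf)
  let C : ι → Set F := fun i => f '' (S i ∩ D)
  have hCo : ∀ i, IsOpen (C i) := fun i =>
    hopen _ ((hSo i).inter hDo) fun x hx => hx.1.2
  -- A point of this dense set lying in every `f '' S i` is in every closure of `C i`, since `D` is
  -- dense in `S i`, and hence in every `C i`.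
  have hA : Dense (⋂ i, (C i ∪ (closure (C i))ᶜ)) := by
    refine dense_iInter_of_isOpen (fun i => (hCo i).union isClosed_closure.isOpen_compl) fun i => ?_
    rw [dense_iff_closure_eq, closure_union, Set.eq_univ_iff_forall]
    intro z
    by_cases hz : z ∈ closure (C i)
    · exact Or.inl hz
    · exact Or.inr (subset_closure hz)
  have hΩ : IsOpen (⋂ i, f '' S i) := isOpen_iInter_of_finite fun i => hopen _ (hSo i) fun x hx => hx.2
  obtain ⟨y', hy'⟩ := hA.inter_open_nonempty _ hΩ
    ⟨y, Set.mem_iInter.2 fun i => ⟨q i, ⟨mem_interior_iff_mem_nhds.2 (hU i), hs i⟩, hq i⟩⟩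
  have hmem : ∀ i, y' ∈ C i := by
    intro i
    refine (Set.mem_iInter.1 hy'.2 i).resolve_right fun h => h ?_
    obtain ⟨z, hz, rfl⟩ := Set.mem_iInter.1 hy'.1 i
    have : z ∈ closure (S i ∩ D) := hD.open_subset_closure_inter (hSo i) hz
    exact image_closure_subset_closure_image hf.continuous ⟨z, this, rfl⟩
  choose q' hq' hfq' using hmem
  exact ⟨q', y', fun i => ⟨interior_subset (hq' i).1.1, (hq' i).2, hfq' i, (hq' i).1.2⟩⟩

/-- A one-parameter family that at parameter `0` is the triangular map `(q, u) ↦ (F q, B (q, u))` is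
open at points where `F` and the partial map `B (q, ·)` are submersions. -/
theorem map_nhds_triangular {Q U X Y : Type*} [NormedAddCommGroup Q] [NormedSpace ℝ Q]
    [NormedAddCommGroup U] [NormedSpace ℝ U] [NormedAddCommGroup X] [NormedSpace ℝ X]
    [NormedAddCommGroup Y] [NormedSpace ℝ Y] [CompleteSpace Q] [CompleteSpace U]
    [CompleteSpace X] [CompleteSpace Y] {F : Q → X} {K : ℝ × Q × U → X} {B : Q × U → Y}
    {L : ℝ × Q × U → Y} (hF : ContDiff ℝ 1 F) (hK : ContDiff ℝ 1 K) (hB : ContDiff ℝ 1 B)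
    (hL : ContDiff ℝ 1 L) {q : Q} {u : U} (hFs : Function.Surjective (fderiv ℝ F q))
    (hBs : ∀ c, ∃ h, fderiv ℝ B (q, u) (0, h) = c) :
    map (fun z : ℝ × Q × U => (z.1, F z.2.1 + z.1 • K z, B z.2 + z.1 • L z)) (𝓝 (0, q, u)) =
      𝓝 (0, F q, B (q, u)) := by
  let z₀ : ℝ × Q × U := (0, q, u)
  have hF' : HasStrictFDerivAt F (fderiv ℝ F q) z₀.2.1 :=
    hF.contDiffAt.hasStrictFDerivAt one_ne_zero
  have hB' : HasStrictFDerivAt B (fderiv ℝ B (q, u)) z₀.2 :=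
    hB.contDiffAt.hasStrictFDerivAt one_ne_zero
  have hK' : HasStrictFDerivAt K (fderiv ℝ K z₀) z₀ := hK.contDiffAt.hasStrictFDerivAt one_ne_zero
  have hL' : HasStrictFDerivAt L (fderiv ℝ L z₀) z₀ := hL.contDiffAt.hasStrictFDerivAt one_ne_zero
  have h₁ : HasStrictFDerivAt (fun z : ℝ × Q × U => z.1) (ContinuousLinearMap.fst ℝ ℝ (Q × U)) z₀ :=
    hasStrictFDerivAt_fst
  have h₂ : HasStrictFDerivAt (fun z : ℝ × Q × U => z.2) (ContinuousLinearMap.snd ℝ ℝ (Q × U)) z₀ :=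
    hasStrictFDerivAt_snd
  have h₃ : HasStrictFDerivAt (fun z : ℝ × Q × U => z.2.1)
      ((ContinuousLinearMap.fst ℝ Q U).comp (ContinuousLinearMap.snd ℝ ℝ (Q × U))) z₀ :=
    h₂.fst
  have hΦ := h₁.prodMk (((hF'.comp z₀ h₃).add (h₁.smul hK')).prodMk
    ((hB'.comp z₀ h₂).add (h₁.smul hL')))
  have := hΦ.map_nhds_eq_of_surj (LinearMap.range_eq_top.2 ?_)
  · simpa [z₀, Function.comp_def] using this
  rintro ⟨τ, a, b⟩
  -- The derivative is block triangular: solve for the `Q` part, then correct with the `U` part.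
  obtain ⟨h, hh⟩ := hFs (a - τ • K z₀)
  obtain ⟨k, hk⟩ := hBs (b - τ • L z₀ - fderiv ℝ B (q, u) (h, 0))
  refine ⟨(τ, h, k), ?_⟩
  have hsplit : fderiv ℝ B (q, u) (h, k) = fderiv ℝ B (q, u) (h, 0) + fderiv ℝ B (q, u) (0, k) := by
    rw [← map_add]; simp
  simp [z₀, hh, hsplit, hk] 

end Submersion

/-! ### Realisations in which the star of a vertex spans -/

section StarMatrix

variable {d : ℕ} {V : Type*}

/-- The matrix whose rows are the vectors from `q (a i)` to `q x`. -/
def starMatrix (x : V) (a : Fin d → V) (q : Realisation ℝ d V) : Matrix (Fin d) (Fin d) ℝ :=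
  Matrix.of fun i => q x - q (a i)

theorem starMatrix_mulVec (x : V) (a : Fin d → V) (q : Realisation ℝ d V) (u : Fin d → ℝ)
    (i : Fin d) : (starMatrix x a q).mulVec u i = u ⬝ᵥ (q x - q (a i)) := by
  rw [dotProduct_comm]
  rfl

theorem isOpen_starMatrix_det_ne_zero (x : V) (a : Fin d → V) :
    IsOpen {q : Realisation ℝ d V | (starMatrix x a q).det ≠ 0} := by
  refine isOpen_ne_fun (Continuous.matrix_det ?_) continuous_const
  refine continuous_matrix fun i j => ?_
  simp only [starMatrix, Matrix.of_apply, Pi.sub_apply]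
  fun_prop

/-- Moving each `a i` by `-s` along the `i`-th axis adds `s` to the diagonal. The determinant
becomes a characteristic polynomial in `s`, with finitely many roots. -/
theorem dense_starMatrix_det_ne_zero {x : V} {a : Fin d → V} (ha : Function.Injective a)
    (hx : ∀ i, a i ≠ x) : Dense {q : Realisation ℝ d V | (starMatrix x a q).det ≠ 0} := by
  classical
  rw [dense_iff_inter_open]
  rintro U hU ⟨q, hq⟩
  let r : Realisation ℝ d V := fun v i => if v = a i then -1 else 0
  have hcont : Continuous fun s : ℝ => q + s • r := by fun_prop
  have hinf : {s : ℝ | q + s • r ∈ U}.Infinite :=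
    infinite_of_mem_nhds 0 ((hU.preimage hcont).mem_nhds (by simpa using hq))
  have hmat : ∀ s : ℝ, starMatrix x a (q + s • r) = Matrix.scalar _ s - -starMatrix x a q := by
    intro s
    ext i j
    have h₁ : r x j = 0 := if_neg (hx j).symm
    have h₂ : r (a i) j = if i = j then -1 else 0 := by simp [r, ha.eq_iff]
    by_cases hij : i = j
    · subst hij
      simp [starMatrix, h₁, h₂]
      ring
    · simp [starMatrix, h₁, h₂, hij]
  have hfin := Polynomial.finite_setOfPred_isRoot (Matrix.charpoly_monic (-starMatrix x a q)).ne_zero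
  obtain ⟨s, hsU, hs⟩ := (hinf.sdiff hfin).nonempty
  refine ⟨q + s • r, hsU, ?_⟩
  change (starMatrix x a (q + s • r)).det ≠ 0
  rw [hmat, ← Matrix.eval_charpoly]
  exact hs

end StarMatrix

end Rigidity

namespace Rigidity

open Topology Filter

/-! ### Unit normals to the common neighbours -/

section Normal

variable {m : ℕ} {V : Type*} {x : V} {a : Fin (m + 1) → V} {q : Realisation ℝ (m + 1) V}

/-- The linear constraints on the direction `u` in which `x` is split, together with its squared
length. -/
def directionMap (x : V) (a : Fin (m + 1) → V) (y : Realisation ℝ (m + 1) V × (Fin (m + 1) → ℝ)) :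
    (Fin m → ℝ) × ℝ :=
  (fun j => 2 * (y.2 ⬝ᵥ (y.1 x - y.1 (a j.castSucc))), y.2 ⬝ᵥ y.2)

theorem contDiff_directionMap [Fintype V] {n : WithTop ℕ∞} : ContDiff ℝ n (directionMap x a) := by
  unfold directionMap dotProduct
  fun_prop

/-- The last column of the inverse star matrix is orthogonal to every row but the last; normalise
it. Its nonzero product with the last row later separates `u` from `-u`. -/
theorem exists_unit_normal (hq : (starMatrix x a q).det ≠ 0) :
    ∃ u : Fin (m + 1) → ℝ, directionMap x a (q, u) = (0, 1) ∧
      u ⬝ᵥ (q x - q (a (Fin.last m))) ≠ 0 := by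
  let w := (starMatrix x a q)⁻¹.mulVec (Pi.single (Fin.last m) 1)
  have hw : ∀ i, w ⬝ᵥ (q x - q (a i)) = (Pi.single (Fin.last m) 1 : Fin (m + 1) → ℝ) i := by
    intro i
    rw [← starMatrix_mulVec, Matrix.mulVec_mulVec, Matrix.mul_nonsing_inv _ hq.isUnit,
      Matrix.one_mulVec]
  have hw0 : w ≠ 0 := by
    intro h
    have := hw (Fin.last m)
    simp [h] at this
  have hpos : 0 < w ⬝ᵥ w := by
    refine lt_of_le_of_ne (Finset.sum_nonneg fun i _ => mul_self_nonneg (w i)) fun h => hw0 ?_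
    exact dotProduct_self_eq_zero.1 h.symm
  have hsq : 0 < √(w ⬝ᵥ w) := Real.sqrt_pos.2 hpos
  refine ⟨(√(w ⬝ᵥ w))⁻¹ • w, ?_, ?_⟩
  · refine Prod.ext (funext fun j => ?_) ?_
    · simp only [directionMap, smul_dotProduct, hw]
      simp [(Fin.castSucc_lt_last j).ne]
    · simp only [directionMap, smul_dotProduct, dotProduct_smul, smul_eq_mul]
      rw [← mul_assoc, ← mul_inv, Real.mul_self_sqrt hpos.le, inv_mul_cancel₀ hpos.ne']
  · rw [smul_dotProduct, hw]
    simpa using hsq.ne'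

theorem fderiv_directionMap_apply [Fintype V] (u h : Fin (m + 1) → ℝ) :
    fderiv ℝ (directionMap x a) (q, u) (0, h) =
      (fun j => 2 * (h ⬝ᵥ (q x - q (a j.castSucc))), 2 * (u ⬝ᵥ h)) := by
  have h₁ : HasDerivAt (fun s : ℝ => directionMap x a (q, u + s • h))
      (fderiv ℝ (directionMap x a) (q, u) (0, h)) 0 := by
    have hF : HasFDerivAt (directionMap x a) (fderiv ℝ (directionMap x a) (q, u))
        (q, u + (0 : ℝ) • h) := by
      rw [zero_smul, add_zero]
      exact (contDiff_directionMap (n := 1).differentiable one_ne_zero (q, u)).hasFDerivAt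
    have hl : HasDerivAt (fun s : ℝ => (q, u + s • h)) (0, h) 0 := by
      have hu : HasDerivAt (fun s : ℝ => u + s • h) h 0 := by
        simpa using ((hasDerivAt_id (0 : ℝ)).smul_const h).const_add u
      exact (hasDerivAt_const (0 : ℝ) q).prodMk hu
    exact HasFDerivAt.comp_hasDerivAt (𝕜 := ℝ) 0 hF hl
  refine h₁.unique (HasDerivAt.prodMk (hasDerivAt_pi.2 fun j => ?_) ?_)
  · simp only [add_dotProduct, smul_dotProduct, smul_eq_mul]
    simpa using (((hasDerivAt_id (0 : ℝ)).mul_const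
      (h ⬝ᵥ (q x - q (a j.castSucc)))).const_add (u ⬝ᵥ (q x - q (a j.castSucc)))).const_mul 2
  · have hexp : ∀ s : ℝ, (u + s • h) ⬝ᵥ (u + s • h) =
        u ⬝ᵥ u + (s * (2 * (u ⬝ᵥ h)) + s ^ 2 * (h ⬝ᵥ h)) := by
      intro s
      simp only [add_dotProduct, smul_dotProduct, dotProduct_add, dotProduct_smul, smul_eq_mul]
      rw [dotProduct_comm h u]
      ring
    simp only [hexp]
    simpa using (((hasDerivAt_id (0 : ℝ)).mul_const (2 * (u ⬝ᵥ h))).add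
      (((hasDerivAt_id (0 : ℝ)).pow 2).mul_const (h ⬝ᵥ h))).const_add (u ⬝ᵥ u)

/-- Invertibility of the star matrix solves the orthogonality part. Adding a multiple of `u`, which
that part does not see, adjusts the length. -/
theorem surjective_fderiv_directionMap [Fintype V] (hq : (starMatrix x a q).det ≠ 0)
    {u : Fin (m + 1) → ℝ} (hu : directionMap x a (q, u) = (0, 1)) (c : (Fin m → ℝ) × ℝ) :
    ∃ h, fderiv ℝ (directionMap x a) (q, u) (0, h) = c := by
  have hu₁ : ∀ j : Fin m, u ⬝ᵥ (q x - q (a j.castSucc)) = 0 := fun j => by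
    simpa [directionMap] using congrFun (congrArg Prod.fst hu) j
  have hu₂ : u ⬝ᵥ u = 1 := congrArg Prod.snd hu
  let b : Fin (m + 1) → ℝ := Fin.snoc (fun j => c.1 j / 2) 0
  let k := (starMatrix x a q)⁻¹.mulVec b
  have hk : ∀ j : Fin m, k ⬝ᵥ (q x - q (a j.castSucc)) = c.1 j / 2 := by
    intro j
    rw [← starMatrix_mulVec, Matrix.mulVec_mulVec, Matrix.mul_nonsing_inv _ hq.isUnit,
      Matrix.one_mulVec]
    simp [b]
  refine ⟨k + (c.2 / 2 - u ⬝ᵥ k) • u, ?_⟩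
  rw [fderiv_directionMap_apply]
  refine Prod.ext (funext fun j => ?_) ?_
  · simp only [add_dotProduct, smul_dotProduct, hk, hu₁, smul_eq_mul]
    ring
  · simp only [dotProduct_add, dotProduct_smul, hu₂, smul_eq_mul]
    ring

end Normal

/-! ### Realisations of the split graph -/

section Split

variable {d : ℕ} {V : Type*}

/-- Data for a realisation of a vertex split: the distance parameter `t`, a realisation of the
original graph, and a direction. -/
abbrev SplitData (d : ℕ) (V : Type*) := ℝ × Realisation ℝ d V × (Fin d → ℝ)

/-- The realisation that places the two copies of `x` at `q x` and `q x + t u`. -/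
def splitRealisation (x : V) (z : SplitData d V) : Realisation ℝ d ({v : V // v ≠ x} ⊕ Fin 2) :=
  Sum.elim (fun v => z.2.1 v) ![z.2.1 x, z.2.1 x + z.1 • z.2.2]

/-- The difference quotient of the squared distance to `v` between the two copies of `x`. -/
def slope (x : V) (z : SplitData d V) (v : V) : ℝ :=
  2 * (z.2.2 ⬝ᵥ (z.2.1 x - z.2.1 v)) + z.1 * (z.2.2 ⬝ᵥ z.2.2)

theorem sqDist_add_smul (x : V) (z : SplitData d V) (v : V) :
    sqDist (z.2.1 x + z.1 • z.2.2) (z.2.1 v) =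
      sqDist (z.2.1 x) (z.2.1 v) + z.1 * slope x z v := by
  rw [sqDist_eq_dotProduct, sqDist_eq_dotProduct, slope, add_sub_right_comm]
  simp only [add_dotProduct, dotProduct_add, smul_dotProduct, dotProduct_smul, smul_eq_mul]
  rw [dotProduct_comm (z.2.1 x - z.2.1 v) z.2.2]
  ring

theorem sqDist_self_add_smul (x : V) (z : SplitData d V) :
    sqDist (z.2.1 x) (z.2.1 x + z.1 • z.2.2) = z.1 ^ 2 * (z.2.2 ⬝ᵥ z.2.2) := by
  rw [sqDist_eq_dotProduct, sub_add_cancel_left, neg_dotProduct_neg]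
  simp only [smul_dotProduct, dotProduct_smul, smul_eq_mul]
  ring

/-- Quantities determined by the congruence class of `splitRealisation x z` and `z.1 ≠ 0`. -/
noncomputable def splitInvariant (x : V) (z : SplitData d V) : (V → V → ℝ) × (V → ℝ) :=
  (fun v w => sqDist (z.2.1 v) (z.2.1 w), slope x z)

theorem continuous_splitInvariant (x : V) :
    Continuous (splitInvariant x : SplitData d V → (V → V → ℝ) × (V → ℝ)) := by
  unfold splitInvariant slope sqDist dotProduct
  fun_prop

/-- Distances to the two copies are preserved, so their difference divided by `t` is too. The slopes
remain meaningful at `t = 0`, where the copies coincide and distances alone do not see `u`. -/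
theorem splitInvariant_eq_of_congruent {x : V} {z z' : SplitData d V}
    (h : Congruent (splitRealisation x z) (splitRealisation x z')) (ht : z.1 = z'.1)
    (h0 : z.1 ≠ 0) : splitInvariant x z = splitInvariant x z' := by
  classical
  let f : V → {v : V // v ≠ x} ⊕ Fin 2 := fun v => if hv : v = x then .inr 0 else .inl ⟨v, hv⟩
  have hf : ∀ (z : SplitData d V) v, splitRealisation x z (f v) = z.2.1 v := by
    intro z v
    by_cases hv : v = x
    · subst hv
      simp [f, splitRealisation]
    · simp [f, hv, splitRealisation]
  have h1 : ∀ v w, sqDist (z.2.1 v) (z.2.1 w) = sqDist (z'.2.1 v) (z'.2.1 w) := by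
    intro v w
    simpa only [hf] using h.sqDist_eq (f v) (f w)
  refine Prod.ext (funext₂ h1) (funext fun v => ?_)
  have h2 : sqDist (z.2.1 x + z.1 • z.2.2) (z.2.1 v) =
      sqDist (z'.2.1 x + z'.1 • z'.2.2) (z'.2.1 v) := by
    have := h.sqDist_eq (.inr 1) (f v)
    rw [hf, hf] at this
    exact this
  rw [sqDist_add_smul, sqDist_add_smul, h1 x v, ← ht] at h2
  exact mul_left_cancel₀ h0 (add_left_cancel h2)

/-- Split data with `t ≠ 0` and generic realisation accumulate at every point with `t = 0`. -/
theorem exists_generic_splitRealisation [Finite V] (x : V) {z₀ : SplitData d V} (h₀ : z₀.1 = 0)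
    {O : Set (SplitData d V)} (hO : O ∈ 𝓝 z₀) :
    ∃ z ∈ O, z.1 ≠ 0 ∧ IsGeneric (splitRealisation x z) := by
  classical
  obtain ⟨A, hA, B, hB, hAB⟩ := mem_nhds_prod_iff.1 hO
  rw [h₀] at hA
  obtain ⟨t, htA, ht0⟩ := ((infinite_of_mem_nhds 0 hA).sdiff (Set.finite_singleton 0)).nonempty
  have ht : t ≠ 0 := ht0
  let f : V → {v : V // v ≠ x} ⊕ Fin 2 := fun v => if hv : v = x then .inr 0 else .inl ⟨v, hv⟩
  -- For fixed `t ≠ 0` this inverts `splitRealisation x (t, ·)`, so density of generic realisations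
  -- passes to split data.
  let g : Realisation ℝ d ({v : V // v ≠ x} ⊕ Fin 2) → Realisation ℝ d V × (Fin d → ℝ) :=
    fun r => (fun v => r (f v), t⁻¹ • (r (.inr 1) - r (.inr 0)))
  have hg : Continuous g := by fun_prop
  have hgs : ∀ y, g (splitRealisation x (t, y)) = y := by
    intro y
    refine Prod.ext (funext fun v => ?_) ?_
    · by_cases hv : v = x
      · subst hv
        simp [g, f, splitRealisation]
      · simp [g, f, hv, splitRealisation]
    · simp [g, splitRealisation, smul_smul, inv_mul_cancel₀ ht]
  have hsg : ∀ r, splitRealisation x (t, g r) = r := by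
    intro r
    funext v
    rcases v with v | i
    · simp [g, f, splitRealisation, v.2]
    · fin_cases i <;> simp [g, f, splitRealisation, smul_smul, mul_inv_cancel₀ ht]
  obtain ⟨r, hr, hgen⟩ := dense_isGeneric.inter_open_nonempty (g ⁻¹' interior B)
    (isOpen_interior.preimage hg) ⟨splitRealisation x (t, z₀.2), by
      rw [Set.mem_preimage, hgs]
      exact mem_interior_iff_mem_nhds.2 hB⟩
  refine ⟨(t, g r), hAB ⟨htA, interior_subset hr⟩, ht, ?_⟩
  rw [hsg]
  exact hgen

end Split

/-! ### The rescaled edge length map of the split -/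

section SplitMap

variable {m : ℕ} {V : Type*} (G : SimpleGraph V) (x : V) (N : Set V) (a : Fin (m + 1) → V)

open Classical in
/-- The correction to the squared length of `e` caused by attaching `e` to the second copy of `x`,
divided by `t`. -/
noncomputable def edgeCorrection (z : SplitData (m + 1) V) (e : G.edgeSet) : ℝ :=
  if h : ∃ v ∈ N, (e : Sym2 V) = s(x, v) then slope x z h.choose else 0

/-- The squared edge lengths of the vertex split, with those of the edges joining the copies of `x`
to each other and to common neighbours replaced by difference quotients. -/
noncomputable def splitMap (z : SplitData (m + 1) V) :
    ℝ × (G.edgeSet → ℝ) × ((Fin m → ℝ) × ℝ) :=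
  (z.1, edgeMap G z.2.1 + z.1 • edgeCorrection G x N z,
    -- The first entries add up to the slopes at `a j.castSucc`; the last is the squared length of
    -- the new edge divided by `t ^ 2`.
    directionMap x a z.2 + z.1 • ((fun _ => z.2.2 ⬝ᵥ z.2.2, 0) : (Fin m → ℝ) × ℝ))

theorem edgeCorrection_of_mem {v : V} (hv : v ∈ N) (h : G.Adj x v) (z : SplitData (m + 1) V) :
    edgeCorrection G x N z ⟨s(x, v), h⟩ = slope x z v := by
  have hex : ∃ w ∈ N, s(x, v) = s(x, w) := ⟨v, hv, rfl⟩
  rw [edgeCorrection, dif_pos hex]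
  rw [← Sym2.congr_right.1 hex.choose_spec.2]

theorem edgeCorrection_of_notMem {v w : V} (hw : ∀ u ∈ N, s(v, w) ≠ s(x, u)) (h : G.Adj v w)
    (z : SplitData (m + 1) V) : edgeCorrection G x N z ⟨s(v, w), h⟩ = 0 := by
  rw [edgeCorrection, dif_neg]
  rintro ⟨u, hu, he⟩
  exact hw u hu he

/-- At `t = 0` the edge part depends on `q` alone and the direction part is a submersion in `u`, so
the map is triangular. -/
theorem map_nhds_splitMap [Fintype V] [Fintype G.edgeSet] {q : Realisation ℝ (m + 1) V}
    {u : Fin (m + 1) → ℝ} (hF : Function.Surjective (fderiv ℝ (edgeMap G) q))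
    (hq : (starMatrix x a q).det ≠ 0) (hu : directionMap x a (q, u) = (0, 1)) :
    map (splitMap G x N a) (𝓝 (0, q, u)) = 𝓝 (0, edgeMap G q, (0, 1)) := by
  rw [← hu]
  refine map_nhds_triangular (contDiff_edgeMap G) ?_ contDiff_directionMap ?_ hF
    (surjective_fderiv_directionMap hq hu)
  · refine contDiff_pi.2 fun e => ?_
    by_cases h : ∃ v ∈ N, (e : Sym2 V) = s(x, v)
    · simp only [edgeCorrection, dif_pos h]
      unfold slope dotProduct
      fun_prop
    · simp only [edgeCorrection, dif_neg h]
      exact contDiff_const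
  · unfold dotProduct
    fun_prop

/-- The corrected length of an edge from `x` to `N 1` is its length at the second copy. For `v ∈ W`,
the length at the first copy and the slope together give the length at the second. -/
theorem equivalent_splitRealisation {N : Fin 2 → Set V} {W : Set V}
    (hN : N 0 ∪ N 1 ∪ W = G.neighborSet x) (h01 : Disjoint (N 0) (N 1)) (h1W : Disjoint (N 1) W)
    (ha : ∀ v ∈ W, ∃ j : Fin m, a j.castSucc = v) {z z' : SplitData (m + 1) V}
    (h : splitMap G x (N 1) a z = splitMap G x (N 1) a z') :
    Equivalent (vertexSplit G x N W) (splitRealisation x z) (splitRealisation x z') := by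
  have ht : z.1 = z'.1 := congrArg (fun y => y.1) h
  have hE : ∀ v w (hvw : G.Adj v w), sqDist (z.2.1 v) (z.2.1 w) +
      z.1 * edgeCorrection G x (N 1) z ⟨s(v, w), hvw⟩ = sqDist (z'.2.1 v) (z'.2.1 w) +
      z.1 * edgeCorrection G x (N 1) z' ⟨s(v, w), hvw⟩ := by
    intro v w hvw
    have := congrFun (congrArg (fun y => y.2.1) h) ⟨s(v, w), hvw⟩
    simpa [splitMap, edgeMap, sqLength_mk, ← ht] using this
  have hadj : ∀ v, v ∈ N 0 ∪ N 1 ∪ W → G.Adj x v := fun v hv => by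
    rw [hN] at hv
    exact hv
  have hlow : ∀ v ∈ N 0 ∪ W, sqDist (z.2.1 x) (z.2.1 v) = sqDist (z'.2.1 x) (z'.2.1 v) := by
    intro v hv
    have hv1 : v ∉ N 1 := fun hv1 => hv.elim (fun h0 => Set.disjoint_left.1 h01 h0 hv1)
      (fun hW => Set.disjoint_left.1 h1W hv1 hW)
    have hne : ∀ u ∈ N 1, s(x, v) ≠ s(x, u) := fun u hu he => hv1 (Sym2.congr_right.1 he ▸ hu)
    have := hE x v (hadj v (hv.elim (fun h => .inl (.inl h)) .inr))
    simpa [edgeCorrection_of_notMem G x (N 1) hne] using this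
  have hslope : ∀ v ∈ W, slope x z v = slope x z' v := by
    intro v hv
    obtain ⟨j, rfl⟩ := ha v hv
    exact congrFun (congrArg (fun y => y.2.2.1) h) j
  have hhigh : ∀ v ∈ N 1 ∪ W, sqDist (z.2.1 x + z.1 • z.2.2) (z.2.1 v) =
      sqDist (z'.2.1 x + z'.1 • z'.2.2) (z'.2.1 v) := by
    intro v hv
    rw [sqDist_add_smul, sqDist_add_smul, ← ht]
    rcases hv with hv | hv
    · have := hE x v (hadj v (.inl (.inr hv)))
      simpa only [edgeCorrection_of_mem G x (N 1) hv] using this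
    · rw [hlow v (.inr hv), hslope v hv]
  have hnorm : z.2.2 ⬝ᵥ z.2.2 = z'.2.2 ⬝ᵥ z'.2.2 := by
    simpa [splitMap, directionMap] using congrArg (fun y => y.2.2.2) h
  have hnew : sqDist (z.2.1 x) (z.2.1 x + z.1 • z.2.2) =
      sqDist (z'.2.1 x) (z'.2.1 x + z'.1 • z'.2.2) := by
    rw [sqDist_self_add_smul, sqDist_self_add_smul, ht, hnorm]
  have hmix : ∀ (i : Fin 2) (v : {v : V // v ≠ x}), (v : V) ∈ N i ∪ W →
      sqDist (splitRealisation x z (.inr i)) (splitRealisation x z (.inl v)) =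
        sqDist (splitRealisation x z' (.inr i)) (splitRealisation x z' (.inl v)) := by
    intro i v hv
    fin_cases i
    · exact hlow v hv
    · exact hhigh v hv
  rintro (v | i) (w | j) hvw
  · have hvw' : G.Adj v w := hvw
    have hne : ∀ u ∈ N 1, s((v : V), (w : V)) ≠ s(x, u) := by
      intro u _ he
      have hx : x ∈ s((v : V), (w : V)) := he ▸ Sym2.mem_mk_left x u
      exact (Sym2.mem_iff.1 hx).elim (fun h => v.2 h.symm) fun h => w.2 h.symm
    have := hE v w hvw'
    simpa [edgeCorrection_of_notMem G x (N 1) hne, splitRealisation] using this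
  · rw [sqDist_comm, sqDist_comm (splitRealisation x z' _)]
    exact hmix j v hvw
  · exact hmix i w hvw
  · have hij : i ≠ j := hvw
    fin_cases i <;> fin_cases j
    · exact absurd rfl hij
    · exact hnew
    · rw [sqDist_comm, sqDist_comm (splitRealisation x z' _)]
      exact hnew
    · exact absurd rfl hij

end SplitMap

end Rigidity

namespace Rigidity

open Topology Filter

/-! ### Doubling a finite family of realisations -/

/-- Points with pairwise distinct images under a continuous map to a Hausdorff space have
neighbourhoods with pairwise disjoint images. -/
theorem exists_nhds_forall_ne {ι X Y : Type*} [Finite ι] [TopologicalSpace X] [TopologicalSpace Y]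
    [T2Space Y] {f : X → Y} (hf : Continuous f) {z : ι → X} (hz : Function.Injective (f ∘ z)) :
    ∃ U : ι → Set X, (∀ i, U i ∈ 𝓝 (z i)) ∧
      ∀ i j, i ≠ j → ∀ y ∈ U i, ∀ y' ∈ U j, f y ≠ f y' := by
  obtain ⟨O, hO, hd⟩ := (Set.finite_range (f ∘ z)).t2_separation
  refine ⟨fun i => f ⁻¹' O (f (z i)), fun i => ?_, fun i j hij y hy y' hy' h => ?_⟩
  · exact ((hO _).2.preimage hf).mem_nhds (hO _).1
  · exact Set.disjoint_left.1 (hd ⟨i, rfl⟩ ⟨j, rfl⟩ fun h => hij (hz h)) hy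
      (Set.mem_preimage.1 (h ▸ hy' : f y ∈ O (f (z j))))

/-- A vertex `x` with `m` other vertices `W` extends to `m + 1` vertices other than `x`. -/
theorem exists_enumeration {m : ℕ} {V : Type*} [Fintype V] (hV : m + 2 ≤ Fintype.card V) {x : V}
    {W : Set V} (hx : x ∉ W) (hW : W.ncard = m) :
    ∃ a : Fin (m + 1) → V, Function.Injective a ∧ (∀ i, a i ≠ x) ∧
      ∀ v ∈ W, ∃ j : Fin m, a j.castSucc = v := by
  let w : W ≃ Fin m := Finite.equivFinOfCardEq hW
  -- The bound on the number of vertices supplies one vertex beyond `x` and `W`; it need not be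
  -- adjacent to `x`.
  obtain ⟨v, hv⟩ : ∃ v, v ∉ insert x W := by
    by_contra! h
    have h₁ : (insert x W).ncard = Fintype.card V := by
      rw [Set.eq_univ_of_forall h, Set.ncard_univ, Nat.card_eq_fintype_card]
    have h₂ := Set.ncard_insert_le x W
    omega
  rw [Set.mem_insert_iff, not_or] at hv
  refine ⟨Fin.snoc (α := fun _ => V) (fun j => (w.symm j : V)) v, ?_, ?_, fun u hu => ?_⟩
  · refine Fin.snoc_injective_of_injective (Subtype.val_injective.comp w.symm.injective) ?_
    rintro ⟨j, hj⟩
    exact hv.2 (hj ▸ (w.symm j).2)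
  · intro i
    induction i using Fin.lastCases with
    | last => simpa using hv.1
    | cast j =>
      rw [Fin.snoc_castSucc]
      exact fun h => hx (h ▸ (w.symm j).2)
  · exact ⟨w ⟨u, hu⟩, by simp⟩

/-- Pairwise non-congruent realisations equivalent to a generic one give rise to twice as many after
a vertex split. -/
theorem exists_split_family {m : ℕ} {V ι : Type*} [Fintype V] [Finite ι] [Nonempty ι]
    {G : SimpleGraph V} (hG : IsMinimallyDRigid (m + 1) G) (hV : m + 2 ≤ Fintype.card V) {x : V}
    {N : Fin 2 → Set V} {W : Set V} (hN : N 0 ∪ N 1 ∪ W = G.neighborSet x)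
    (h01 : Disjoint (N 0) (N 1)) (h1W : Disjoint (N 1) W) (hW : W.ncard = m)
    {p : Realisation ℝ (m + 1) V} (hp : IsGeneric p) {q : ι → Realisation ℝ (m + 1) V}
    (hq : ∀ i, Equivalent G p (q i)) (hne : ∀ i j, i ≠ j → ¬ Congruent (q i) (q j)) :
    ∃ p' : Realisation ℝ (m + 1) ({v : V // v ≠ x} ⊕ Fin 2), IsGeneric p' ∧
      ∃ r : ι × Bool → Realisation ℝ (m + 1) ({v : V // v ≠ x} ⊕ Fin 2),
        (∀ α, Equivalent (vertexSplit G x N W) p' (r α)) ∧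
        ∀ α β, α ≠ β → ¬ Congruent (r α) (r β) := by
  classical
  have hxW : x ∉ W := fun hx => by
    have : x ∈ G.neighborSet x := hN ▸ Or.inr hx
    exact G.loopless.irrefl x this
  obtain ⟨a, ha, hax, haW⟩ := exists_enumeration hV hxW hW
  have : Fintype G.edgeSet := Fintype.ofFinite _
  -- Move the given realisations to ones in which the star of `x` spans.
  have hqE : ∀ i, edgeMap G (q i) = edgeMap G p := fun i =>
    ((equivalent_iff_edgeMap G).1 (hq i)).symm
  have hsurj : ∀ i, Function.Surjective (fderiv ℝ (edgeMap G) (q i)) := fun i => by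
    refine surjective_fderiv_edgeMap G ?_
    rw [hqE i]
    exact hG.algebraicIndependent_sqLength hp
  let dist : Realisation ℝ (m + 1) V → V → V → ℝ := fun q v w => sqDist (q v) (q w)
  have hdist : Continuous dist := by
    unfold dist sqDist
    fun_prop
  obtain ⟨U, hU, hUne⟩ := exists_nhds_forall_ne (z := q) hdist fun i j hij => by
    by_contra h
    exact hne i j h (congruent_of_sqDist_eq fun v w => congrFun (congrFun hij v) w)
  obtain ⟨q', y, hq'⟩ := exists_perturbation_mem_dense (contDiff_edgeMap G) hqE hsurj hU
    (isOpen_starMatrix_det_ne_zero x a) (dense_starMatrix_det_ne_zero ha hax)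
  -- Each of them splits in the two directions normal to the common neighbours.
  choose n hn hn' using fun i => exists_unit_normal (hq' i).2.1
  let σ : Bool → ℝ := fun b => cond b 1 (-1)
  let z : ι × Bool → SplitData (m + 1) V := fun α => (0, q' α.1, σ α.2 • n α.1)
  have hdir : ∀ α : ι × Bool, directionMap x a (q' α.1, σ α.2 • n α.1) = (0, 1) := by
    rintro ⟨i, b⟩
    rw [← hn i]
    have h0 := congrArg Prod.fst (hn i)
    cases b
    · refine Prod.ext (funext fun j => ?_) ?_
      · have := congrFun h0 j
        simp only [directionMap, Pi.zero_apply] at this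
        simp only [directionMap, smul_dotProduct, smul_eq_mul]
        linear_combination (σ false - 1) * this
      · simp [directionMap, σ]
    · simp [σ]
  have hmap : ∀ α, map (splitMap G x (N 1) a) (𝓝 (z α)) = 𝓝 (0, y, (0, 1)) := fun α => by
    rw [map_nhds_splitMap G x (N 1) a (hq' α.1).2.2.2 (hq' α.1).2.1 (hdir α), (hq' α.1).2.2.1]
  have hinj : Function.Injective (splitInvariant x ∘ z) := by
    rintro ⟨i, b⟩ ⟨j, c⟩ h
    have hij : i = j := by
      by_contra hij
      exact hUne i j hij _ (hq' i).1 _ (hq' j).1 (congrArg Prod.fst h)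
    subst hij
    -- At `t = 0` the slope at the extra vertex is nonzero and changes sign with `u`.
    have hs := congrFun (congrArg Prod.snd h) (a (Fin.last m))
    simp only [Function.comp_apply, splitInvariant, slope, z, zero_mul, add_zero,
      smul_dotProduct, smul_eq_mul] at hs
    have hσ : σ b = σ c := mul_right_cancel₀ (hn' i) (mul_left_cancel₀ two_ne_zero hs)
    have hbc : b = c := by
      cases b <;> cases c <;> simp [σ] at hσ ⊢ <;> norm_num at hσ
    rw [hbc]
  obtain ⟨O, hO, hOne⟩ := exists_nhds_forall_ne (continuous_splitInvariant x) hinj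
  have hT : ⋂ α, splitMap G x (N 1) a '' O α ∈ 𝓝 ((0, y, (0, 1)) :
      ℝ × (G.edgeSet → ℝ) × ((Fin m → ℝ) × ℝ)) :=
    (iInter_mem).2 fun α => by
      rw [← hmap α]
      exact image_mem_map (hO α)
  obtain ⟨i₀⟩ := ‹Nonempty ι›
  -- A neighbourhood of the common value is covered by the image of every `O α`. Pulling it back to
  -- one limit point gives generic data `ζ` whose fibre meets every `O α`.
  rw [← hmap (i₀, true)] at hT
  obtain ⟨ζ, hζ, hζ0, hgen⟩ := exists_generic_splitRealisation x rfl (mem_map.1 hT)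
  choose ξ hξO hξ using fun α => Set.mem_iInter.1 hζ α
  have hξ1 : ∀ α, (ξ α).1 = ζ.1 := fun α => congrArg (fun y => y.1) (hξ α)
  refine ⟨splitRealisation x ζ, hgen, fun α => splitRealisation x (ξ α), fun α => ?_,
    fun α β hαβ hc => ?_⟩
  · exact equivalent_splitRealisation G x a hN h01 h1W haW (hξ α).symm
  · exact hOne α β hαβ _ (hξO α) _ (hξO β)
      (splitInvariant_eq_of_congruent hc ((hξ1 α).trans (hξ1 β).symm) (hξ1 α ▸ hζ0))

/-! ### Counting congruence classes -/

section Count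

variable {d : ℕ} {V V' : Type*}

theorem card_le_realisationCount {G : SimpleGraph V} {p : Realisation ℝ d V} {ι : Type*}
    {r : ι → Realisation ℝ d V} (hr : ∀ i, Equivalent G p (r i))
    (hne : ∀ i j, i ≠ j → ¬ Congruent (r i) (r j)) : ENat.card ι ≤ realisationCount G p := by
  refine ENat.card_le_card_of_injective
    (f := fun i => (Quotient.mk (congruenceSetoid G p) ⟨r i, hr i⟩)) fun i j hij => ?_
  by_contra h
  exact hne i j h (Quotient.exact hij)

/-- The real realisation number is invariant under isomorphism. -/
theorem realRealisationNumber_le_of_iso {G : SimpleGraph V} {G' : SimpleGraph V'} (φ : G' ≃g G) :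
    realRealisationNumber d G ≤ realRealisationNumber d G' := by
  refine iSup₂_le fun p hp => ?_
  have hp' : IsGeneric fun v : V' => p (φ v) :=
    AlgebraicIndependent.comp hp (fun vi : V' × Fin d => (φ vi.1, vi.2))
      (fun a b h => Prod.ext (φ.injective (congrArg Prod.fst h)) (congrArg Prod.snd h :))
  refine le_trans ?_ (le_iSup₂ (f := fun p (_ : IsGeneric p) => realisationCount G' p) _ hp')
  refine card_le_realisationCount (ι := Quotient (congruenceSetoid G p))
    (r := fun c v => c.out.1 (φ v)) (fun c v w h => ?_) fun c c' hcc hcong => hcc ?_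
  · exact c.out.2 _ _ (φ.map_rel_iff.2 h)
  · obtain ⟨A, b, h₁, h₂, h⟩ := hcong
    rw [← Quotient.out_eq c, ← Quotient.out_eq c']
    refine Quotient.sound ⟨A, b, h₁, h₂, fun v => ?_⟩
    simpa using h (φ.symm v)

/-- The perturbation argument handles finitely many realisations at a time, so an infinite count is
reached through its finite subsets. -/
theorem two_mul_enatCard_le {α : Type*} {b : ℕ∞}
    (h : ∀ s : Finset α, s.Nonempty → 2 * (s.card : ℕ∞) ≤ b) : 2 * ENat.card α ≤ b := by
  have h' : ∀ s : Finset α, 2 * (s.card : ℕ∞) ≤ b := fun s =>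
    s.eq_empty_or_nonempty.elim (fun hs => by simp [hs]) (h s)
  rcases finite_or_infinite α with hα | hα
  · have := Fintype.ofFinite α
    simpa using h' Finset.univ
  · have : b = ⊤ := ENat.eq_top_iff_forall_ge.2 fun n => by
      obtain ⟨s, hs⟩ := Infinite.exists_subset_card_eq α n
      refine le_trans ?_ (h' s)
      rw [hs, two_mul]
      exact le_self_add
    rw [this]
    exact le_top

end Count

end Rigidity

theorem mainTheorem5 {V V' : Type*} [Fintype V] [Fintype V'] (d : ℕ) (hd : 1 ≤ d)
    (G : SimpleGraph V) (G' : SimpleGraph V')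
    (hG : Rigidity.IsMinimallyDRigid d G) (hV : d + 1 ≤ Fintype.card V)
    (hG' : Rigidity.IsVertexSplit d G G') :
    2 * Rigidity.realRealisationNumber d G ≤ Rigidity.realRealisationNumber d G' := by
  -- The truncated `d - 1` in the definition of the split becomes `m`.
  obtain ⟨m, rfl⟩ : ∃ m, d = m + 1 := ⟨d - 1, by omega⟩
  obtain ⟨x, N, W, hN, h01, -, h1W, hW, ⟨φ⟩⟩ := hG'
  refine le_trans ?_ (Rigidity.realRealisationNumber_le_of_iso φ)
  unfold Rigidity.realRealisationNumber
  simp only [ENat.mul_iSup]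
  refine iSup₂_le fun p hp => Rigidity.two_mul_enatCard_le fun s hs => ?_
  have : Nonempty s := hs.to_subtype
  obtain ⟨p', hp', r, hr, hrne⟩ := Rigidity.exists_split_family (ι := s) hG hV hN h01 h1W hW hp
    (q := fun c => c.1.out.1) (fun c => c.1.out.2) fun c c' hcc hcong => hcc (Subtype.ext (by
      rw [← Quotient.out_eq c.1, ← Quotient.out_eq c'.1]
      exact Quotient.sound hcong))
  refine le_trans ?_ (le_iSup₂ (f := fun p (_ : Rigidity.IsGeneric p) =>
    Rigidity.realisationCount (Rigidity.vertexSplit G x N W) p) p' hp')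
  refine le_trans (le_of_eq ?_) (Rigidity.card_le_realisationCount hr hrne)
  rw [ENat.card_eq_coe_fintype_card]
  simp [mul_comm]
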